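/- Let $\mathbb{F}_{q^M}$ be an extension of degree $M$ of a finite field $\mathbb{F}_q$, and for $v\in\mathbb{F}_{q^M}^n$ let $\operatorname{rank}(v)$ be the rank over $\mathbb{F}_q$ of the $M\times n$ matrix obtained by expanding each coordinate of $v$ as a column with respect to a fixed basis of $\mathbb{F}_{q^M}$ over $\mathbb{F}_q$. Let $1\le k\le n$, let $P(D)=\sum_{i=0}^m P_iD^i$ with $P_i\in\mathbb{F}_{q^M}^{k\times(n-k)}$, and let $G(D)=[I_k\ \ P(D)]=\sum_i G_iD^i$ be a systematic encoder of memory $m$ (that is, $G_m\ne0$ and $G_i=0$ for $i>m$) of the convolutional code $\mathcal{C}=\{u(D)G(D) : u(D)\in\mathbb{F}_{q^M}[D]^k\}$. Let $0\le j\le m$, and let $$d^j_{SR}(\mathcal{C})=\min\Big\{\sum_{i=0}^j\operatorname{rank}(v_i) : v(D)=\sum_i v_iD^i\in\mathcal{C},\ v_0\neq0\Big\}$$ be the $j$-th column sum-rank distance. For $A_\ell\in\mathbb{F}_q^{(n-k)\times(n-k)}$, $B_\ell\in\mathbb{F}_q^{k\times k}$, $C_\ell\in\mathbb{F}_q^{k\times(n-k)}$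 ($0\le\ell\le j$) put $$T_j=\operatorname{diag}(B_0,\dots,B_j)\begin{bmatrix}P_0&P_1&\cdots&P_j\\&P_0&\cdots&P_{j-1}\\&&\ddots&\vdots\\&&&P_0\end{bmatrix}\operatorname{diag}(A_0,\dots,A_j)+\operatorname{diag}(C_0,\dots,C_j),$$ and for $0\le s\le t\le j$ let $T_{s,t}$ be the block of $T_j$ in block row $s$ and block column $t$ (the blocks with $s>t$ are zero). Then the following are equivalent. 1. $d^j_{SR}(\mathcal{C})=(j+1)(n-k)+1$. 2. For all matrices $C_\ell$ and all nonsingular upper triangular matrices $A_\ell,B_\ell$ over $\mathbb{F}_q$, every square submatrix of $T_j$ (rows and columns in their original order) with all its diagonal entries in the blocks $T_{s,t}$, $s\le t$, is nonsingular. 3. For all such $A_\ell,B_\ell,C_\ell$, the matrix $T_j$ is superregular as a block upper triangular matrix: every square submatrix is nonsingular unless each term $\mu_{1,\sigma(1)}\cdots\mu_{\nu,\sigma(\nu)}$ of its determinant contains an entry from the zero region below the blocks $T_{s,t}$, $s\le t$. 4. For all such $A_\ell,B_\ell,C_\ell$, all entries of the blocks $T_{s,t}$, $s\le t$, are nonzero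 and $T_j$ is superregular, meaning that every square submatrix of $T_j$ whose determinant has at least one nonzero term $\mu_{1,\sigma(1)}\cdots\mu_{\nu,\sigma(\nu)}$ is nonsingular. -/

import Mathlib

namespace MSR

/-- The coefficient matrix `G_i` of `D ^ i` in a polynomial matrix `G(D) = ∑ i, G_i D ^ i`. -/
def coeffMatrix {F κ ι : Type*} [Field F] (G : Matrix κ ι (Polynomial F)) (i : ℕ) :
    Matrix κ ι F :=
  G.map fun p => p.coeff i

/-- The polynomial matrix `G(D)` has memory `m`: `G_m ≠ 0` and `G_i = 0` for `i > m`. -/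
def HasMemory {F κ ι : Type*} [Field F] (G : Matrix κ ι (Polynomial F)) (m : ℕ) : Prop :=
  coeffMatrix G m ≠ 0 ∧ ∀ i, m < i → coeffMatrix G i = 0

/-- The convolutional code `{u(D) G(D) | u(D)}` generated by `G(D)`, as a module over the
polynomial ring. -/
noncomputable def convCode {F κ ι : Type*} [Field F] [Fintype κ]
    (G : Matrix κ ι (Polynomial F)) : Submodule (Polynomial F) (ι → Polynomial F) :=
  LinearMap.range G.vecMulLinear

/-- The systematic encoder `[I_k, P(D)]`. -/
noncomputable def systematicEncoder {F : Type*} [Field F] {k r : ℕ}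
    (P : Matrix (Fin k) (Fin r) (Polynomial F)) :
    Matrix (Fin k) (Fin k ⊕ Fin r) (Polynomial F) :=
  Matrix.fromCols 1 P

/-- The vector `v_i` of coefficients of `D ^ i` in a polynomial vector `v(D)`. -/
def coeffVec {F ι : Type*} [Field F] (v : ι → Polynomial F) (i : ℕ) : ι → F :=
  fun l => (v l).coeff i

/-- The rank of a vector over the extension field: the rank over the base field of the
`M × n` matrix obtained by expanding each coordinate in the basis `b` (as a column). -/
noncomputable def rankWeight {K F ι : Type*} [Field K] [Field F] [Algebra K F] [Fintype ι]
    {M : ℕ} (b : Module.Basis (Fin M) K F) (v : ι → F) : ℕ :=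
  (b.toMatrix v).rank

/-- The `j`-th column sum-rank distance: the minimum of `rank v_0 + ⋯ + rank v_j` over the
codewords `v(D)` with `v_0 ≠ 0`. (The infimum of a nonempty set of natural numbers is its
minimum; the set is nonempty whenever some codeword has `v_0 ≠ 0`.) -/
noncomputable def columnDistance {K F ι : Type*} [Field K] [Field F] [Algebra K F] [Fintype ι]
    {M : ℕ} (b : Module.Basis (Fin M) K F)
    (C : Submodule (Polynomial F) (ι → Polynomial F)) (j : ℕ) : ℕ :=
  sInf {d | ∃ v ∈ C, coeffVec v 0 ≠ 0 ∧
    d = ∑ i ∈ Finset.range (j + 1), rankWeight b (coeffVec v i)}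

/-- Index set of `j + 1` consecutive blocks of size `a`, ordered block after block. -/
abbrev BlockIdx (j a : ℕ) : Type := Fin (j + 1) ×ₗ Fin a

/-- The number of the block to which a row or column index belongs. -/
def blk {j a : ℕ} (x : BlockIdx j a) : Fin (j + 1) := (ofLex x).1

/-- The position of an index inside its block. -/
def pos {j a : ℕ} (x : BlockIdx j a) : Fin a := (ofLex x).2

/-- The block diagonal matrix `diag(A_0, …, A_j)`. -/
def blockDiag {F : Type*} [Field F] {j a c : ℕ}
    (A : Fin (j + 1) → Matrix (Fin a) (Fin c) F) : Matrix (BlockIdx j a) (BlockIdx j c) F :=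
  Matrix.of fun x y => if blk x = blk y then A (blk x) (pos x) (pos y) else 0

/-- The block upper triangular Toeplitz matrix with block `P_{t-s}` in block row `s` and block
column `t` for `s ≤ t`, and zero blocks for `t < s`. -/
def slidingMatrix {F : Type*} [Field F] {a c : ℕ} (P : ℕ → Matrix (Fin a) (Fin c) F) (j : ℕ) :
    Matrix (BlockIdx j a) (BlockIdx j c) F :=
  Matrix.of fun x y =>
    if blk x ≤ blk y then P ((blk y : ℕ) - (blk x : ℕ)) (pos x) (pos y) else 0

/-- `T_j = diag(B_ℓ) · (sliding matrix of P_0, …, P_j) · diag(A_ℓ) + diag(C_ℓ)`, where the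
`A_ℓ`, `B_ℓ`, `C_ℓ` have their entries in the base field `K`. -/
def matrixT {K F : Type*} [Field K] [Field F] [Algebra K F] {k r : ℕ}
    (P : Matrix (Fin k) (Fin r) (Polynomial F)) (j : ℕ)
    (A : Fin (j + 1) → Matrix (Fin r) (Fin r) K) (B : Fin (j + 1) → Matrix (Fin k) (Fin k) K)
    (C : Fin (j + 1) → Matrix (Fin k) (Fin r) K) : Matrix (BlockIdx j k) (BlockIdx j r) F :=
  blockDiag (fun l => (B l).map (algebraMap K F)) * slidingMatrix (coeffMatrix P) j *
      blockDiag (fun l => (A l).map (algebraMap K F)) +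
    blockDiag (fun l => (C l).map (algebraMap K F))

/-- Nonsingular upper triangular matrices. -/
def IsNonsingularUpper {K : Type*} [Field K] {a : ℕ} (A : Matrix (Fin a) (Fin a) K) : Prop :=
  A.BlockTriangular id ∧ A.det ≠ 0

/-- The position `(x, y)` lies in one of the blocks `T_{s,t}`, `s ≤ t`, on or above the block
diagonal. -/
def InBlocks {j a c : ℕ} (x : BlockIdx j a) (y : BlockIdx j c) : Prop := blk x ≤ blk y

/-- Superregular: every square submatrix whose determinant has at least one nonzero term
`μ_{1,σ(1)} ⋯ μ_{ν,σ(ν)}` is nonsingular. -/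
def IsSuperregular {F α β : Type*} [Field F] [LinearOrder α] [LinearOrder β]
    (T : Matrix α β F) : Prop :=
  ∀ (ν : ℕ) (r : Fin ν ↪o α) (c : Fin ν ↪o β),
    (∃ σ : Equiv.Perm (Fin ν), ∏ i, T.submatrix r c i (σ i) ≠ 0) → (T.submatrix r c).det ≠ 0

/-- Superregular with respect to a prescribed shape `S` (the positions outside `S` being the
zeros that the form of the matrix prescribes): every square submatrix whose determinant has at
least one term with all its factors in positions of `S` is nonsingular. -/
def IsSuperregularOfShape {F α β : Type*} [Field F] [LinearOrder α] [LinearOrder β]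
    (S : α → β → Prop) (T : Matrix α β F) : Prop :=
  ∀ (ν : ℕ) (r : Fin ν ↪o α) (c : Fin ν ↪o β),
    (∃ σ : Equiv.Perm (Fin ν), ∀ i, S (r i) (c (σ i))) → (T.submatrix r c).det ≠ 0

/-- Every square submatrix of `T` with all its diagonal entries in the blocks `T_{s,t}`,
`s ≤ t`, is nonsingular. -/
def DiagSubmatricesNonsingular {F : Type*} [Field F] {j a c : ℕ}
    (T : Matrix (BlockIdx j a) (BlockIdx j c) F) : Prop :=
  ∀ (ν : ℕ) (x : Fin ν ↪o BlockIdx j a) (y : Fin ν ↪o BlockIdx j c),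
    (∀ i, InBlocks (x i) (y i)) → (T.submatrix x y).det ≠ 0

end MSR

/-!
Write `r = n - k`. A message `u` has as its codeword, in block `t`, the pair of `u_t` and the
redundancy `w_t = ∑ s ≤ t, u_s P_{t-s}`, and the rank of this block is the dimension of the
`K`-span of the entries of both (`rankWeight_codeword`). Both the distance condition and the
condition on minors are turned into statements about tails `[τ, j]` of blocks, which are then
compared block by block.

*Distance.* A single unit vector as message has weight at most `(j + 1) r + 1`, so the distance has
this value iff no message with `u_0 ≠ 0` has weight at most `(j + 1) r` (`columnDistance_eq_iff`).
By shifting and truncating messages this says: for each message not vanishing on `[0, j]`, some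
tail of the codeword has weight more than `r` per block (`forall_lt_sum_blockWeight_iff`).

*Minors.* A submatrix with its diagonal inside the blocks is singular iff a nonzero row vector `z`
supported on its rows has `z T` vanish on its columns. Choosing rows and columns in increasing
order, the diagonal condition becomes a comparison of tail counts: all these submatrices are
nonsingular iff for each `z ≠ 0` some tail contains more nonzero entries of `z` than zeros of `z T`
(`diagSubmatricesNonsingular_iff`).

*Comparison.* For `u = z diag(B_t)`, block `t` of `z T_j` is `w_t A_t + z_t C_t`. The rank of
block `t` is at most the number of nonzero entries of `z_t` and of `w_t A_t + z_t C_t`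
(`finrank_span_block_add_card_le`); conversely, column reduction yields upper triangular `A_t`,
`B_t` and some `C_t` for which this number is at most the rank (`exists_reduced_block`). Summing over
a tail gives `columnDistance_eq_iff_diagSubmatricesNonsingular`.

The remaining equivalences are combinatorial: if some transversal of a submatrix stays inside the
blocks then so does its diagonal (`inBlocks_diag_of_perm`), and `T_j` vanishes outside the blocks.
-/

namespace MSR

open Module
open scoped Matrix

/-! ### Square submatrices and block counts -/

/-- If some transversal of a square submatrix stays inside the block shape, so does the diagonal:
by the pigeonhole principle some `i' ≥ i` has `σ i' ≤ i`. -/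
theorem inBlocks_diag_of_perm {j a c ν : ℕ} (x : Fin ν ↪o BlockIdx j a)
    (y : Fin ν ↪o BlockIdx j c) (σ : Equiv.Perm (Fin ν))
    (h : ∀ i, InBlocks (x i) (y (σ i))) (i : Fin ν) : InBlocks (x i) (y i) := by
  obtain ⟨i', hi, hσ⟩ : ∃ i', i ≤ i' ∧ σ i' ≤ i := by
    by_contra! hcon
    have hsub : (Finset.Ici i).image σ ⊆ Finset.Ioi i := by
      intro l hl
      obtain ⟨i', hi', rfl⟩ := Finset.mem_image.1 hl
      exact Finset.mem_Ioi.2 (hcon i' (Finset.mem_Ici.1 hi'))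
    have hcard := Finset.card_le_card hsub
    rw [Finset.card_image_of_injective _ σ.injective, Fin.card_Ici, Fin.card_Ioi] at hcard
    omega
  exact (Prod.Lex.monotone_fst _ _ (x.monotone hi)).trans
    ((h i').trans (Prod.Lex.monotone_fst _ _ (y.monotone hσ)))

/-- The number of elements of `X` in the blocks from block `τ` on. -/
def tailCard {j a : ℕ} (X : Finset (BlockIdx j a)) (τ : Fin (j + 1)) : ℕ :=
  (X.filter fun x => τ ≤ blk x).card

/-- Two index sets whose tail counts dominate each other can be matched, in increasing order, with
every matched pair inside the block shape: match `X` with the last `X.card` elements of `Y`. -/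
theorem exists_orderEmb_inBlocks {j a c : ℕ} (X : Finset (BlockIdx j a))
    (Y : Finset (BlockIdx j c)) (h : ∀ τ, tailCard X τ ≤ tailCard Y τ) :
    ∃ (x : Fin X.card ↪o BlockIdx j a) (y : Fin X.card ↪o BlockIdx j c),
      Set.range x = X ∧ (∀ i, y i ∈ Y) ∧ ∀ i, InBlocks (x i) (y i) := by
  have hXY : X.card ≤ Y.card := by
    have := h 0
    simpa [tailCard] using this
  obtain ⟨d, hd⟩ := Nat.exists_eq_add_of_le' hXY
  let e := Y.orderEmbOfFin hd
  let y : Fin X.card ↪o BlockIdx j c := (Fin.natAddOrderEmb d).trans e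
  refine ⟨X.orderEmbOfFin rfl, y, by simp, fun i => Y.orderEmbOfFin_mem hd _, fun i => ?_⟩
  set x := X.orderEmbOfFin rfl
  by_contra hlt
  have hlt : blk (y i) < blk (x i) := not_le.1 hlt
  have h1 : (Finset.Ici i).card ≤ tailCard X (blk (x i)) := by
    rw [← Finset.card_map x.toEmbedding]
    refine Finset.card_le_card fun l hl => ?_
    obtain ⟨i', hi', rfl⟩ := Finset.mem_map.1 hl
    exact Finset.mem_filter.2 ⟨X.orderEmbOfFin_mem rfl _,
      Prod.Lex.monotone_fst _ _ (x.monotone (Finset.mem_Ici.1 hi'))⟩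
  have h2 : tailCard Y (blk (x i)) ≤ (Finset.Ioi i).card := by
    rw [← Finset.card_map y.toEmbedding]
    refine Finset.card_le_card fun l hl => ?_
    obtain ⟨hlY, hl⟩ := Finset.mem_filter.1 hl
    obtain ⟨p, rfl⟩ : l ∈ Set.range e := by
      rw [Finset.range_orderEmbOfFin]; exact hlY
    have hp : Fin.natAdd d i < p := by
      by_contra hp
      exact absurd (hlt.trans_le hl)
        (not_lt.2 (Prod.Lex.monotone_fst _ _ (e.monotone (not_lt.1 hp))))
    obtain ⟨p', rfl⟩ : ∃ p', Fin.natAdd d p' = p := by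
      have hp := Fin.lt_def.1 hp
      simp only [Fin.val_natAdd] at hp
      exact ⟨⟨p - d, by omega⟩, Fin.ext (by simp; omega)⟩
    exact Finset.mem_map.2 ⟨p', by simpa using hp, rfl⟩
  have := (h1.trans (h _)).trans h2
  rw [Fin.card_Ici, Fin.card_Ioi] at this
  omega

open Classical in
/-- The kernel form of the condition on minors: a vector supported on the rows of a
singular submatrix and killed by its columns has, in every tail of blocks, at most as many nonzero
entries as its product with `T` has zeros. -/
theorem diagSubmatricesNonsingular_iff {F : Type*} [Field F] {j a c : ℕ}
    (T : Matrix (BlockIdx j a) (BlockIdx j c) F) :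
    DiagSubmatricesNonsingular T ↔ ∀ z : BlockIdx j a → F, z ≠ 0 →
      ∃ τ, tailCard (Finset.univ.filter fun y => (z ᵥ* T) y = 0) τ <
        tailCard (Finset.univ.filter fun x => z x ≠ 0) τ := by
  constructor
  · intro h z hz
    by_contra! hcon
    obtain ⟨x, y, hx, hy, hxy⟩ := exists_orderEmb_inBlocks _ _ hcon
    refine h _ x y hxy (Matrix.exists_vecMul_eq_zero_iff.1 ⟨z ∘ x, fun h0 => hz ?_, ?_⟩)
    · funext l
      by_contra hl
      obtain ⟨i, rfl⟩ : l ∈ Set.range x := by rw [hx]; simpa using hl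
      exact hl (congrFun h0 i)
    · funext i
      have hi := (Finset.mem_filter.1 (hy i)).2
      refine Eq.trans ?_ hi
      simp only [Matrix.vecMul, dotProduct]
      refine Finset.sum_of_injOn x x.injective.injOn (by simp) (fun l _ hl => ?_) (by simp)
      have : z l = 0 := by
        by_contra hl'
        refine hl ?_
        rw [Finset.coe_univ, Set.image_univ, hx]
        simpa using hl'
      simp [this]
  · intro h ν x y hxy hdet
    obtain ⟨z', hz', hz0⟩ := Matrix.exists_vecMul_eq_zero_iff.2 hdet
    have hext : ∀ i, Function.extend x z' 0 (x i) = z' i := x.injective.extend_apply _ _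
    obtain ⟨τ, hτ⟩ := h (Function.extend x z' 0) (fun h0 => hz' (funext fun i => by
      rw [← hext i, h0]; rfl))
    refine absurd hτ (not_lt.2 ?_)
    calc tailCard _ τ ≤ (Finset.univ.filter fun i => τ ≤ blk (x i)).card := by
          rw [← Finset.card_map x.toEmbedding]
          refine Finset.card_le_card fun l hl => ?_
          simp only [Finset.mem_filter, Finset.mem_univ, true_and] at hl
          obtain ⟨i, rfl⟩ : l ∈ Set.range x := by
            by_contra hl'
            exact hl.1 (Function.extend_apply' _ _ _ (by simpa using hl'))
          exact Finset.mem_map.2 ⟨i, by simpa using hl.2, rfl⟩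
      _ ≤ (Finset.univ.filter fun i => τ ≤ blk (y i)).card :=
          Finset.card_le_card (Finset.monotone_filter_right _ fun i _ hi => le_trans hi (hxy i))
      _ ≤ tailCard _ τ := by
          rw [← Finset.card_map y.toEmbedding]
          refine Finset.card_le_card fun l hl => ?_
          obtain ⟨i, hi, rfl⟩ := Finset.mem_map.1 hl
          simp only [Finset.mem_filter, Finset.mem_univ, true_and] at hi ⊢
          refine ⟨?_, hi⟩
          have h0 := congrFun hz0 i
          rw [Pi.zero_apply] at h0
          rw [← h0]
          simp only [Matrix.vecMul, dotProduct]
          refine (Finset.sum_of_injOn x x.injective.injOn (by simp) (fun l _ hl => ?_)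
            (fun i _ => by simp [hext])).symm
          rw [Function.extend_apply' _ _ _ (by simpa using hl)]
          simp

/-! ### Echelon forms over the base field -/

theorem vecMul_map_algebraMap {K F ι κ : Type*} [Field K] [Field F] [Algebra K F] [Fintype ι]
    (f : ι → F) (A : Matrix ι κ K) (l : κ) :
    (f ᵥ* A.map (algebraMap K F)) l = ∑ i, A i l • f i := by
  simp [Matrix.vecMul, dotProduct, Algebra.smul_def, mul_comm]

theorem vecMul_map_algebraMap_mem_span {K F ι κ : Type*} [Field K] [Field F] [Algebra K F]
    [Fintype ι] (f : ι → F) (A : Matrix ι κ K) (l : κ) :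
    (f ᵥ* A.map (algebraMap K F)) l ∈ Submodule.span K (Set.range f) := by
  rw [vecMul_map_algebraMap]
  exact Submodule.sum_smul_mem _ _ fun i _ => Submodule.subset_span ⟨i, rfl⟩

theorem IsNonsingularUpper.inv {K : Type*} [Field K] {a : ℕ} {A : Matrix (Fin a) (Fin a) K}
    (hA : IsNonsingularUpper A) : IsNonsingularUpper A⁻¹ := by
  have hu : IsUnit A.det := isUnit_iff_ne_zero.2 hA.2
  have := A.invertibleOfIsUnitDet hu
  exact ⟨Matrix.blockTriangular_inv_of_blockTriangular hA.1,
    (A.isUnit_nonsing_inv_det hu).ne_zero⟩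

theorem vecMul_map_inv_cancel {K F ι : Type*} [Field K] [Field F] [Algebra K F] [Fintype ι]
    [DecidableEq ι] (f : ι → F) {A : Matrix ι ι K} (hA : A.det ≠ 0) :
    (f ᵥ* A.map (algebraMap K F)) ᵥ* A⁻¹.map (algebraMap K F) = f := by
  rw [Matrix.vecMul_vecMul, ← Matrix.map_mul, A.mul_nonsing_inv (isUnit_iff_ne_zero.2 hA)]
  simp

/-- The span of `W` and the first `l` vectors of the family `f`. -/
def prefixSpan {K V : Type*} [Field K] [AddCommGroup V] [Module K V] {a : ℕ}
    (W : Submodule K V) (f : Fin a → V) (l : ℕ) : Submodule K V :=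
  W ⊔ Submodule.span K (f '' {i | (i : ℕ) < l})

theorem exists_monic_comb_eq_zero {K V : Type*} [Field K] [AddCommGroup V] [Module K V] {a : ℕ}
    (W : Submodule K V) (f : Fin a → V) (l : Fin a) (hl : f l ∈ prefixSpan W f l) :
    ∃ (d : Fin a → K) (w : V), w ∈ W ∧ (∀ i, l < i → d i = 0) ∧ d l = 1 ∧
      ∑ i, d i • f i + w = 0 := by
  obtain ⟨w, hw, y, hy, hwy⟩ := Submodule.mem_sup.1 hl
  have hset : {i : Fin a | (i : ℕ) < l} = ((Finset.Iio l : Finset (Fin a)) : Set (Fin a)) := by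
    ext i; simp
  rw [hset, Submodule.mem_span_image_finset_iff_exists_fun'] at hy
  obtain ⟨d, hd⟩ := hy
  refine ⟨fun i => if i < l then -d i else if i = l then 1 else 0, -w, W.neg_mem hw,
    fun i hi => by simp [hi.not_gt, hi.ne'], by simp, ?_⟩
  have hsplit : ∀ i, (if i < l then -d i else if i = l then (1 : K) else 0) • f i =
      (if i < l then -(d i • f i) else 0) + if i = l then f i else 0 := by
    intro i
    by_cases h1 : i < l
    · simp [h1, h1.ne]
    · by_cases h2 : i = l <;> simp [h2, h1]
  have hI : Finset.univ.filter (fun i => i < l) = Finset.Iio l := by ext; simp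
  rw [Finset.sum_congr rfl fun i _ => hsplit i, Finset.sum_add_distrib, Finset.sum_ite_eq',
    ← Finset.sum_filter, Finset.sum_neg_distrib, hI, hd, if_pos (Finset.mem_univ _), ← hwy]
  abel

open Classical in
/-- Each entry outside the span of `W` and its predecessors raises the dimension of the span. -/
theorem finrank_add_card_notMem_prefixSpan_le {K V : Type*} [Field K] [AddCommGroup V]
    [Module K V] [FiniteDimensional K V] {a : ℕ} (W : Submodule K V) (f : Fin a → V) (l : ℕ)
    (hl : l ≤ a) :
    finrank K W +
      (Finset.univ.filter fun i : Fin a => (i : ℕ) < l ∧ f i ∉ prefixSpan W f i).card ≤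
      finrank K (prefixSpan W f l) := by
  have hmono : ∀ l, prefixSpan W f l ≤ prefixSpan W f (l + 1) := by
    intro l
    have hset : {i : Fin a | (i : ℕ) < l} ⊆ {i : Fin a | (i : ℕ) < l + 1} := fun i hi =>
      Nat.lt_succ_of_lt hi
    exact sup_le_sup_left (Submodule.span_mono (Set.image_mono hset)) W
  induction l with
  | zero =>
    have : finrank K W ≤ finrank K (prefixSpan W f 0) := Submodule.finrank_mono le_sup_left
    simpa using this
  | succ l ih =>
    have ih := ih (by omega)
    by_cases hf : f ⟨l, hl⟩ ∈ prefixSpan W f l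
    · refine le_trans (Nat.add_le_add_left (Finset.card_le_card fun i hi => ?_) _)
        (ih.trans (Submodule.finrank_mono (hmono l)))
      simp only [Finset.mem_filter, Finset.mem_univ, true_and] at hi ⊢
      refine ⟨lt_of_le_of_ne (Nat.lt_succ_iff.1 hi.1) ?_, hi.2⟩
      rintro rfl
      exact hi.2 hf
    · have hlt : prefixSpan W f l < prefixSpan W f (l + 1) := by
        refine lt_of_le_of_ne (hmono l) fun he => hf ?_
        rw [he]
        exact Submodule.mem_sup_right (Submodule.subset_span ⟨⟨l, hl⟩, by simp, rfl⟩)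
      have hfin := Submodule.finrank_lt_finrank_of_lt hlt
      have hins : (Finset.univ.filter fun i : Fin a => (i : ℕ) < l + 1 ∧
            f i ∉ prefixSpan W f i) ⊆ insert ⟨l, hl⟩
          (Finset.univ.filter fun i : Fin a => (i : ℕ) < l ∧ f i ∉ prefixSpan W f i) := by
        intro i hi
        simp only [Finset.mem_filter, Finset.mem_univ, true_and, Finset.mem_insert,
          Fin.ext_iff] at hi ⊢
        rcases Nat.lt_succ_iff_lt_or_eq.1 hi.1 with h | h
        · exact Or.inr ⟨h, hi.2⟩
        · exact Or.inl h
      have := (Finset.card_le_card hins).trans (Finset.card_insert_le _ _)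
      omega

open Classical in
/-- Column reduction of a row of vectors modulo a subspace `W`: every entry lying in the span of `W`
and the earlier entries is cleared, and the entries that remain are independent modulo `W`. -/
theorem exists_upper_echelon {K V : Type*} [Field K] [AddCommGroup V] [Module K V]
    [FiniteDimensional K V] {a : ℕ} (W : Submodule K V) (f : Fin a → V) :
    ∃ (A : Matrix (Fin a) (Fin a) K) (w : Fin a → V), IsNonsingularUpper A ∧ (∀ l, w l ∈ W) ∧
      finrank K W + (Finset.univ.filter fun l => ∑ i, A i l • f i + w l ≠ 0).card ≤
        finrank K (W ⊔ Submodule.span K (Set.range f) : Submodule K V) := by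
  have hcol : ∀ l : Fin a, ∃ (d : Fin a → K) (w : V), w ∈ W ∧ (∀ i, l < i → d i = 0) ∧ d l = 1 ∧
      (f l ∈ prefixSpan W f l → ∑ i, d i • f i + w = 0) := by
    intro l
    by_cases hl : f l ∈ prefixSpan W f l
    · obtain ⟨d, w, hw, hlt, hone, hzero⟩ := exists_monic_comb_eq_zero W f l hl
      exact ⟨d, w, hw, hlt, hone, fun _ => hzero⟩
    · exact ⟨Pi.single l 1, 0, W.zero_mem, fun i hi => by simp [hi.ne'], by simp,
        fun h => absurd h hl⟩
  choose d w hw hlt hone hzero using hcol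
  have hA : (Matrix.of fun i l => d l i).BlockTriangular id := fun i l hil => hlt l i hil
  refine ⟨Matrix.of fun i l => d l i, w, ⟨hA, ?_⟩, hw, ?_⟩
  · rw [Matrix.det_of_isUpperTriangular hA]
    simp [hone]
  have htop : prefixSpan W f a = W ⊔ Submodule.span K (Set.range f) := by
    have hset : {i : Fin a | (i : ℕ) < a} = Set.univ := by ext i; simp
    rw [prefixSpan, hset, Set.image_univ]
  rw [← htop]
  refine le_trans (Nat.add_le_add_left (Finset.card_le_card fun l hl => ?_) _)
    (finrank_add_card_notMem_prefixSpan_le W f a le_rfl)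
  exact Finset.mem_filter.2 ⟨Finset.mem_univ _, l.2, fun h =>
    (Finset.mem_filter.1 hl).2 (hzero l h)⟩

open Classical in
/-- A message block and its redundancy can be brought to a form whose numbers of nonzero entries
are bounded by the ranks: reduce the message block first, then the redundancy modulo the span
of the message block. -/
theorem exists_reduced_block {K F : Type*} [Field K] [Field F] [Algebra K F]
    [FiniteDimensional K F] {k r : ℕ} (u : Fin k → F) (w : Fin r → F) :
    ∃ (A : Matrix (Fin r) (Fin r) K) (B : Matrix (Fin k) (Fin k) K) (C : Matrix (Fin k) (Fin r) K)
      (z : Fin k → F), IsNonsingularUpper A ∧ IsNonsingularUpper B ∧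
      z ᵥ* B.map (algebraMap K F) = u ∧
      (Finset.univ.filter fun i => z i ≠ 0).card + r ≤
        finrank K (Submodule.span K (Set.range u) ⊔ Submodule.span K (Set.range w) :
          Submodule K F) +
        (Finset.univ.filter fun l => (w ᵥ* A.map (algebraMap K F) +
          z ᵥ* C.map (algebraMap K F)) l = 0).card := by
  obtain ⟨B, w₀, hB, hw₀, hcardB⟩ := exists_upper_echelon (⊥ : Submodule K F) u
  obtain ⟨A, w₁, hA, hw₁, hcardA⟩ := exists_upper_echelon (Submodule.span K (Set.range u)) w
  have hw₀ : ∀ l, w₀ l = 0 := fun l => by simpa using hw₀ l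
  set z := u ᵥ* B.map (algebraMap K F) with hz
  have hzB : z ᵥ* B⁻¹.map (algebraMap K F) = u := vecMul_map_inv_cancel u hB.2
  have hspan : Submodule.span K (Set.range u) ≤ Submodule.span K (Set.range z) := by
    rw [Submodule.span_le]
    rintro _ ⟨i, rfl⟩
    rw [← hzB]
    exact vecMul_map_algebraMap_mem_span z _ i
  -- the corrections `w₁` lie in the span of `u`, hence of `z`; their coefficients form `C`
  have hC : ∀ l, ∃ d : Fin k → K, ∑ i, d i • z i = w₁ l := fun l =>
    (Submodule.mem_span_range_iff_exists_fun K).1 (hspan (hw₁ l))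
  choose d hd using hC
  refine ⟨A, B⁻¹, Matrix.of fun i l => d l i, z, hA, hB.inv, hzB, ?_⟩
  simp only [Pi.add_apply, vecMul_map_algebraMap, Matrix.of_apply, hd]
  have hsplit := Finset.card_filter_add_card_filter_not (s := (Finset.univ : Finset (Fin r)))
    (fun l => ∑ i, A i l • w i + w₁ l = 0)
  have hzc : (Finset.univ.filter fun i => z i ≠ 0).card =
      (Finset.univ.filter fun l => ∑ i, B i l • u i + w₀ l ≠ 0).card := by
    simp only [hz, vecMul_map_algebraMap, hw₀, add_zero]
  rw [finrank_bot, zero_add, bot_sup_eq] at hcardB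
  rw [Finset.card_univ, Fintype.card_fin] at hsplit
  simp only [ne_eq] at *
  omega

open Classical in
/-- Conversely, the span of a message block and its redundancy lies in the span of the nonzero
entries of any transform of this form, since `A` is invertible. -/
theorem finrank_span_block_add_card_le {K F : Type*} [Field K] [Field F] [Algebra K F]
    {k r : ℕ} (w : Fin r → F) {A : Matrix (Fin r) (Fin r) K}
    (hA : A.det ≠ 0) {B : Matrix (Fin k) (Fin k) K} (C : Matrix (Fin k) (Fin r) K)
    {z u : Fin k → F} (hu : z ᵥ* B.map (algebraMap K F) = u) :
    finrank K (Submodule.span K (Set.range u) ⊔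
        Submodule.span K (Set.range w) : Submodule K F) +
      (Finset.univ.filter fun l => (w ᵥ* A.map (algebraMap K F) +
          z ᵥ* C.map (algebraMap K F)) l = 0).card ≤
      (Finset.univ.filter fun i => z i ≠ 0).card + r := by
  subst hu
  set g := w ᵥ* A.map (algebraMap K F) + z ᵥ* C.map (algebraMap K F) with hg
  let S : Finset F := (Finset.univ.filter fun i => z i ≠ 0).image z ∪
    (Finset.univ.filter fun l => ¬ g l = 0).image g
  have hz : Submodule.span K (Set.range z) ≤ Submodule.span K (S : Set F) := by
    rw [Submodule.span_le]
    rintro _ ⟨i, rfl⟩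
    by_cases hi : z i = 0
    · rw [hi]; exact Submodule.zero_mem _
    · exact Submodule.subset_span (Finset.mem_union_left _
        (Finset.mem_image_of_mem _ (by simpa using hi)))
  have hgS : ∀ l, g l ∈ Submodule.span K (S : Set F) := fun l => by
    by_cases hl : g l = 0
    · rw [hl]; exact Submodule.zero_mem _
    · exact Submodule.subset_span (Finset.mem_union_right _
        (Finset.mem_image_of_mem _ (by simpa using hl)))
  have hwA : Submodule.span K (Set.range (w ᵥ* A.map (algebraMap K F))) ≤
      Submodule.span K (S : Set F) := by
    rw [Submodule.span_le]
    rintro _ ⟨l, rfl⟩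
    have : (w ᵥ* A.map (algebraMap K F)) l = g l - (z ᵥ* C.map (algebraMap K F)) l := by
      simp [hg]
    rw [this]
    exact Submodule.sub_mem _ (hgS l) (hz (vecMul_map_algebraMap_mem_span z C l))
  have hle : Submodule.span K (Set.range (z ᵥ* B.map (algebraMap K F))) ⊔
      Submodule.span K (Set.range w) ≤ Submodule.span K (S : Set F) := by
    refine sup_le (Submodule.span_le.2 ?_) (Submodule.span_le.2 ?_)
    · rintro _ ⟨l, rfl⟩
      exact hz (vecMul_map_algebraMap_mem_span z B l)
    · rintro _ ⟨l, rfl⟩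
      rw [← vecMul_map_inv_cancel w hA]
      exact hwA (vecMul_map_algebraMap_mem_span _ _ l)
  have hfin := (Submodule.finrank_mono hle).trans (finrank_span_finset_le_card S)
  have hS : S.card ≤ _ := (Finset.card_union_le _ _).trans
    (Nat.add_le_add Finset.card_image_le Finset.card_image_le)
  have hsplit := Finset.card_filter_add_card_filter_not (s := (Finset.univ : Finset (Fin r)))
    (fun l => g l = 0)
  rw [Finset.card_univ, Fintype.card_fin] at hsplit
  omega

/-! ### Sum-rank weights of truncated codewords -/

theorem rankWeight_eq_finrank_span {K F ι : Type*} [Field K] [Field F] [Algebra K F] [Fintype ι]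
    {M : ℕ} (b : Basis (Fin M) K F) (v : ι → F) :
    rankWeight b v = finrank K (Submodule.span K (Set.range v)) := by
  have hcol : Set.range (b.toMatrix v).col = b.equivFun '' Set.range v := by
    rw [← Set.range_comp]
    rfl
  rw [rankWeight, Matrix.rank_eq_finrank_span_cols, hcol]
  have := Submodule.map_span (b.equivFun : F →ₗ[K] Fin M → K) (Set.range v)
  rw [LinearEquiv.coe_coe] at this
  rw [← this]
  exact LinearEquiv.finrank_map_eq b.equivFun _

/-- The second part of the coefficient of `D ^ t` in the codeword of the message `∑ i, u i D ^ i`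
under the encoder `[I, P(D)]`. -/
def redundancy {F : Type*} [Field F] {k r : ℕ} (P : Matrix (Fin k) (Fin r) (Polynomial F))
    (u : ℕ → Fin k → F) (t : ℕ) : Fin r → F :=
  ∑ s ∈ Finset.range (t + 1), u s ᵥ* coeffMatrix P (t - s)

/-- The rank over `K` of the coefficient of `D ^ t` in the codeword of the message
`∑ i, u i D ^ i`, as the dimension of the span of its entries. -/
noncomputable def blockWeight (K : Type*) {F : Type*} [Field K] [Field F] [Algebra K F] {k r : ℕ}
    (P : Matrix (Fin k) (Fin r) (Polynomial F)) (u : ℕ → Fin k → F) (t : ℕ) : ℕ :=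
  finrank K (Submodule.span K (Set.range (u t)) ⊔
    Submodule.span K (Set.range (redundancy P u t)) : Submodule K F)

theorem coeffVec_vecMul_systematicEncoder {F : Type*} [Field F] {k r : ℕ}
    (P : Matrix (Fin k) (Fin r) (Polynomial F)) (U : Fin k → Polynomial F) (t : ℕ) :
    coeffVec (U ᵥ* systematicEncoder P) t =
      Sum.elim (coeffVec U t) (redundancy P (coeffVec U) t) := by
  funext l
  rcases l with l | l
  · simp [coeffVec, systematicEncoder, Matrix.vecMul_fromCols]
  · simp only [coeffVec, systematicEncoder, Sum.elim_inr, redundancy,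
      Matrix.vecMul, dotProduct, Polynomial.finsetSum_coeff, Finset.sum_apply, coeffMatrix,
      Matrix.map_apply, Polynomial.coeff_mul]
    rw [Finset.sum_comm]
    exact Finset.Nat.sum_antidiagonal_eq_sum_range_succ
      (fun s s' => ∑ i, (U i).coeff s * (P i l).coeff s') t

section

variable {K F : Type*} [Field K] [Field F] [Algebra K F] {k r : ℕ}
  (P : Matrix (Fin k) (Fin r) (Polynomial F))

theorem redundancy_congr {u u' : ℕ → Fin k → F} {t : ℕ} (h : ∀ s ≤ t, u s = u' s) :
    redundancy P u t = redundancy P u' t :=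
  Finset.sum_congr rfl fun s hs => by rw [h s (Nat.lt_succ_iff.1 (Finset.mem_range.1 hs))]

theorem blockWeight_congr {u u' : ℕ → Fin k → F} {t : ℕ} (h : ∀ s ≤ t, u s = u' s) :
    blockWeight K P u t = blockWeight K P u' t := by
  rw [blockWeight, blockWeight, redundancy_congr P h, h t le_rfl]

/-- Dropping `τ` leading zero blocks of a message shifts its codeword by `τ` steps. -/
theorem blockWeight_shift {u : ℕ → Fin k → F} {τ : ℕ} (h : ∀ s < τ, u s = 0) (t : ℕ) :
    blockWeight K P (fun s => u (τ + s)) t = blockWeight K P u (τ + t) := by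
  have hred : redundancy P (fun s => u (τ + s)) t = redundancy P u (τ + t) := by
    rw [redundancy, redundancy, add_assoc, Finset.sum_range_add _ τ (t + 1),
      Finset.sum_eq_zero (s := Finset.range τ), zero_add]
    · refine Finset.sum_congr rfl fun s _ => ?_
      rw [Nat.add_sub_add_left]
    · intro s hs
      rw [h s (Finset.mem_range.1 hs), Matrix.zero_vecMul]
  rw [blockWeight, blockWeight, hred]

theorem blockWeight_le_of_eq_zero {u : ℕ → Fin k → F} {t : ℕ} (h : u t = 0) :
    blockWeight K P u t ≤ r := by
  have h0 : Submodule.span K (Set.range (u t)) = ⊥ := by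
    rw [Submodule.span_eq_bot, h]
    rintro _ ⟨i, rfl⟩
    rfl
  rw [blockWeight, h0, bot_sup_eq]
  exact (finrank_range_le_card _).trans (Fintype.card_fin r).le

theorem sum_range_blockWeight_le_of_tail_eq_zero {u : ℕ → Fin k → F} {a : ℕ} {N : ℕ} (haN : a ≤ N)
    (ha : ∑ t ∈ Finset.range a, blockWeight K P u t ≤ a * r) (hu : ∀ t, a ≤ t → u t = 0) :
    ∑ t ∈ Finset.range N, blockWeight K P u t ≤ N * r := by
  induction N, haN using Nat.le_induction with
  | base => exact ha
  | succ N hN ih =>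
    rw [Finset.sum_range_succ, Nat.succ_mul]
    exact Nat.add_le_add ih (blockWeight_le_of_eq_zero P (hu N hN))

/-- The maximal column distance property only constrains messages with `u 0 ≠ 0`, but, by shifting
and truncating messages, it amounts to this: for each message that does not vanish on `[0, j]`,
some tail of the truncated codeword exceeds the weight `r` per block. -/
theorem forall_lt_sum_blockWeight_iff (j : ℕ) :
    (∀ u : ℕ → Fin k → F, u 0 ≠ 0 →
      (j + 1) * r < ∑ t ∈ Finset.range (j + 1), blockWeight K P u t) ↔
    ∀ u : ℕ → Fin k → F, (∃ t ≤ j, u t ≠ 0) → ∃ τ ≤ j,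
      (j + 1 - τ) * r < ∑ t ∈ Finset.Ico τ (j + 1), blockWeight K P u t := by
  classical
  constructor
  · intro h u hu
    let τ := Nat.find hu
    obtain ⟨hτj, hτ⟩ : τ ≤ j ∧ u τ ≠ 0 := Nat.find_spec hu
    have hlow : ∀ s < τ, u s = 0 := fun s hs => by
      by_contra hs0
      exact Nat.find_min hu hs ⟨hs.le.trans hτj, hs0⟩
    refine ⟨τ, hτj, ?_⟩
    by_contra! hle
    -- start the message at its first nonzero block and cut it off past `j`, so that each of the
    -- `τ` blocks added at the end has weight at most `r`
    let u' : ℕ → Fin k → F := fun s => if s < j + 1 - τ then u (τ + s) else 0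
    have hu' : u' 0 ≠ 0 := by
      simpa [u', show 0 < j + 1 - τ by omega] using hτ
    refine absurd (h u' hu') (not_lt.2 (sum_range_blockWeight_le_of_tail_eq_zero P
      (Nat.sub_le (j + 1) τ) ?_ fun t ht => by simp [u', not_lt.2 ht]))
    rw [Finset.sum_Ico_eq_sum_range] at hle
    refine le_trans (le_of_eq (Finset.sum_congr rfl fun t ht => ?_)) hle
    rw [← blockWeight_shift P hlow t]
    refine blockWeight_congr P fun s hs => ?_
    simp [u', lt_of_le_of_lt hs (Finset.mem_range.1 ht)]
  · intro h u hu0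
    by_contra! hle
    -- truncate at the shortest prefix whose weight is at most `r` per block
    have hex : ∃ i, ∑ t ∈ Finset.range (i + 1), blockWeight K P u t ≤ (i + 1) * r := ⟨j, hle⟩
    let i := Nat.find hex
    have hi : ∑ t ∈ Finset.range (i + 1), blockWeight K P u t ≤ (i + 1) * r := Nat.find_spec hex
    have hij : i ≤ j := Nat.find_min' hex hle
    have hpre : ∀ τ ≤ i, τ * r ≤ ∑ t ∈ Finset.range τ, blockWeight K P u t := by
      rintro (_ | τ) hτ
      · simp
      · exact (not_le.1 (Nat.find_min hex (Nat.lt_of_succ_le hτ))).le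
    let u' : ℕ → Fin k → F := fun s => if s < i + 1 then u s else 0
    have heq : ∀ t < i + 1, blockWeight K P u' t = blockWeight K P u t := fun t ht =>
      blockWeight_congr P fun s hs => if_pos (lt_of_le_of_lt hs ht)
    obtain ⟨τ, hτj, hτ⟩ := h u' ⟨0, Nat.zero_le _, by simpa [u'] using hu0⟩
    refine absurd hτ (not_lt.2 ?_)
    by_cases hτi : τ ≤ i
    · have htot := sum_range_blockWeight_le_of_tail_eq_zero (K := K) P (u := u')
        (Nat.succ_le_succ hij) (by
          rwa [Finset.sum_congr rfl fun t ht => heq t (Finset.mem_range.1 ht)])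
        (fun t ht => if_neg (not_lt.2 ht))
      rw [← Finset.sum_range_add_sum_Ico _ (show τ ≤ j + 1 by omega),
        Finset.sum_congr rfl fun t ht => heq t
          ((Finset.mem_range.1 ht).trans_le (hτi.trans (Nat.le_succ i)))] at htot
      rw [Nat.sub_mul]
      exact Nat.le_sub_of_add_le' ((Nat.add_le_add_right (hpre τ hτi) _).trans htot)
    · calc _ ≤ ∑ _t ∈ Finset.Ico τ (j + 1), r := Finset.sum_le_sum fun t ht =>
            blockWeight_le_of_eq_zero P (by
              have := (Finset.mem_Ico.1 ht).1
              exact if_neg (by omega))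
        _ = _ := by simp

theorem rankWeight_codeword {M : ℕ} (b : Basis (Fin M) K F) (U : Fin k → Polynomial F) (t : ℕ) :
    rankWeight b (coeffVec (U ᵥ* systematicEncoder P) t) = blockWeight K P (coeffVec U) t := by
  rw [rankWeight_eq_finrank_span, coeffVec_vecMul_systematicEncoder, Set.Sum.elim_range,
    Submodule.span_union, blockWeight]

/-- A message consisting of a single unit vector has weight at most `(j + 1) * r + 1`, so the column
distance has this value as soon as no codeword has smaller weight. -/
theorem columnDistance_eq_iff {M : ℕ} (b : Basis (Fin M) K F) (hk : 0 < k) (j : ℕ) :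
    columnDistance b (convCode (systematicEncoder P)) j = (j + 1) * r + 1 ↔
      ∀ u : ℕ → Fin k → F, u 0 ≠ 0 →
        (j + 1) * r < ∑ t ∈ Finset.range (j + 1), blockWeight K P u t := by
  classical
  set S := {d | ∃ v ∈ convCode (systematicEncoder P), coeffVec v 0 ≠ 0 ∧
    d = ∑ i ∈ Finset.range (j + 1), rankWeight b (coeffVec v i)} with hS
  have hmem : ∀ u : ℕ → Fin k → F, u 0 ≠ 0 →
      ∑ t ∈ Finset.range (j + 1), blockWeight K P u t ∈ S := by
    intro u hu
    let U : Fin k → Polynomial F := fun l =>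
      ∑ i ∈ Finset.range (j + 1), Polynomial.monomial i (u i l)
    have hU : ∀ t < j + 1, coeffVec U t = u t := by
      intro t ht
      funext l
      simp [coeffVec, U, Polynomial.coeff_monomial, Nat.lt_succ_iff.1 ht]
    refine ⟨U ᵥ* systematicEncoder P, ⟨U, rfl⟩, fun h0 => hu ?_, ?_⟩
    · rw [coeffVec_vecMul_systematicEncoder] at h0
      rw [← hU 0 (Nat.succ_pos j)]
      funext l
      exact congrFun h0 (Sum.inl l)
    · refine Finset.sum_congr rfl fun t ht => ?_
      rw [rankWeight_codeword]
      exact blockWeight_congr P fun s hs =>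
        (hU s (lt_of_le_of_lt hs (Finset.mem_range.1 ht))).symm
  have hS' : ∀ d ∈ S, ∃ u : ℕ → Fin k → F, u 0 ≠ 0 ∧
      d = ∑ t ∈ Finset.range (j + 1), blockWeight K P u t := by
    rintro d ⟨v, ⟨U, rfl⟩, hv, rfl⟩
    refine ⟨coeffVec U, fun h0 => hv ?_, Finset.sum_congr rfl fun t _ =>
      rankWeight_codeword P b U t⟩
    change coeffVec (U ᵥ* systematicEncoder P) 0 = 0
    rw [coeffVec_vecMul_systematicEncoder]
    funext l
    rcases l with l | l <;> simp [redundancy, h0]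
  obtain ⟨d, hdS, hd⟩ : ∃ d ∈ S, d ≤ (j + 1) * r + 1 := by
    let u : ℕ → Fin k → F := fun t => if t = 0 then Pi.single ⟨0, hk⟩ 1 else 0
    have hu : u 0 ≠ 0 := fun h0 => by simpa [u] using congrFun h0 ⟨0, hk⟩
    refine ⟨_, hmem u hu, ?_⟩
    have hzero : blockWeight K P u 0 ≤ r + 1 := by
      have h1 : Submodule.span K (Set.range (u 0)) ≤ Submodule.span K {1} := by
        rw [Submodule.span_le]
        rintro _ ⟨l, rfl⟩
        by_cases hl : l = ⟨0, hk⟩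
        · exact Submodule.subset_span (by simp [u, hl])
        · simp [u, hl]
      have := b.finiteDimensional_of_finite
      refine (Submodule.finrank_add_le_finrank_add_finrank _ _).trans ?_
      rw [add_comm]
      exact Nat.add_le_add ((finrank_range_le_card _).trans (Fintype.card_fin r).le)
        ((Submodule.finrank_mono h1).trans (finrank_span_singleton one_ne_zero).le)
    rw [Finset.sum_range_succ', Nat.succ_mul, add_assoc]
    refine Nat.add_le_add ?_ hzero
    calc _ ≤ ∑ _t ∈ Finset.range j, r := Finset.sum_le_sum fun t _ =>
          blockWeight_le_of_eq_zero P (by simp [u])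
      _ = j * r := by simp
  change sInf S = _ ↔ _
  constructor
  · intro h u hu
    have := Nat.sInf_le (hmem u hu)
    omega
  · intro h
    refine le_antisymm ((Nat.sInf_le hdS).trans hd) ?_
    obtain ⟨u, hu, he⟩ := hS' _ (Nat.sInf_mem ⟨d, hdS⟩)
    rw [he]
    exact h u hu

/-! ### The matrices `T_j` acting on messages -/

theorem sum_blockIdx {N : Type*} [AddCommMonoid N] {j a : ℕ} (f : BlockIdx j a → N) :
    ∑ x, f x = ∑ t, ∑ i, f (toLex (t, i)) :=
  (toLex.sum_comp f).symm.trans (Fintype.sum_prod_type _)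

theorem vecMul_blockDiag {j a c : ℕ} (z : BlockIdx j a → F)
    (A : Fin (j + 1) → Matrix (Fin a) (Fin c) F) (y : BlockIdx j c) :
    (z ᵥ* blockDiag A) y = ((fun i => z (toLex (blk y, i))) ᵥ* A (blk y)) (pos y) := by
  simp only [Matrix.vecMul, dotProduct, sum_blockIdx]
  rw [Finset.sum_eq_single (blk y)]
  · simp [blockDiag, blk, pos]
  · intro t _ ht
    refine Finset.sum_eq_zero fun i _ => ?_
    have : ¬ blk (toLex (t, i) : BlockIdx j a) = blk y := ht
    simp [blockDiag, this]
  · simp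

theorem vecMul_slidingMatrix {j : ℕ} {z : BlockIdx j k → F} {u : ℕ → Fin k → F}
    (hu : ∀ t : Fin (j + 1), u t = fun i => z (toLex (t, i))) (y : BlockIdx j r) :
    (z ᵥ* slidingMatrix (coeffMatrix P) j) y = redundancy P u (blk y) (pos y) := by
  let g : ℕ → F := fun s =>
    if s ≤ blk y then (u s ᵥ* coeffMatrix P ((blk y : ℕ) - s)) (pos y) else 0
  have hsub : ∀ s : Fin (j + 1), (∑ i, z (toLex (s, i)) *
      slidingMatrix (coeffMatrix P) j (toLex (s, i)) y) = g s := by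
    intro s
    have hs : ∀ i, slidingMatrix (coeffMatrix P) j (toLex (s, i)) y =
        if (s : ℕ) ≤ blk y then coeffMatrix P ((blk y : ℕ) - s) i (pos y) else 0 := fun i => rfl
    by_cases h : (s : ℕ) ≤ blk y <;> simp [g, hs, hu, h, Matrix.vecMul, dotProduct]
  have hrange : (Finset.range (j + 1)).filter (fun s => s ≤ (blk y : ℕ)) =
      Finset.range ((blk y : ℕ) + 1) := by
    ext s
    have := (blk y).2
    simp only [Finset.mem_filter, Finset.mem_range]
    omega
  calc (z ᵥ* slidingMatrix (coeffMatrix P) j) y = ∑ s : Fin (j + 1), g s := by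
        simp only [Matrix.vecMul, dotProduct, sum_blockIdx, hsub]
    _ = redundancy P u (blk y) (pos y) := by
        rw [Fin.sum_univ_eq_sum_range, ← Finset.sum_filter, hrange, redundancy, Finset.sum_apply]

/-- The row `z * T_j` in block `t`, where `u = z * diag(B_0, …, B_j)` is the associated message. -/
theorem vecMul_matrixT {j : ℕ} (A : Fin (j + 1) → Matrix (Fin r) (Fin r) K)
    (B : Fin (j + 1) → Matrix (Fin k) (Fin k) K) (C : Fin (j + 1) → Matrix (Fin k) (Fin r) K)
    {z : BlockIdx j k → F} {u : ℕ → Fin k → F}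
    (hu : ∀ t : Fin (j + 1), u t = (fun i => z (toLex (t, i))) ᵥ* (B t).map (algebraMap K F))
    (t : Fin (j + 1)) (l : Fin r) :
    (z ᵥ* matrixT P j A B C) (toLex (t, l)) =
      (redundancy P u t ᵥ* (A t).map (algebraMap K F) +
        (fun i => z (toLex (t, i))) ᵥ* (C t).map (algebraMap K F)) l := by
  have hzB : ∀ t : Fin (j + 1), u t = fun i =>
      (z ᵥ* blockDiag fun l => (B l).map (algebraMap K F)) (toLex (t, i)) := by
    intro t
    funext i
    rw [vecMul_blockDiag, hu]
    rfl
  rw [matrixT, Matrix.vecMul_add, ← Matrix.vecMul_vecMul, ← Matrix.vecMul_vecMul, Pi.add_apply,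
    Pi.add_apply, vecMul_blockDiag, vecMul_blockDiag]
  simp only [vecMul_slidingMatrix P hzB]
  rfl

theorem matrixT_eq_zero {j : ℕ} (A : Fin (j + 1) → Matrix (Fin r) (Fin r) K)
    (B : Fin (j + 1) → Matrix (Fin k) (Fin k) K) (C : Fin (j + 1) → Matrix (Fin k) (Fin r) K)
    {x : BlockIdx j k} {y : BlockIdx j r} (hxy : ¬ InBlocks x y) :
    matrixT P j A B C x y = 0 := by
  have hlt : blk y < blk x := not_le.1 hxy
  have hdiag : ¬ blk x = blk y := hlt.ne'
  simp only [matrixT, Matrix.add_apply, Matrix.mul_apply]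
  have hC : blockDiag (fun l => (C l).map (algebraMap K F)) x y = 0 := by simp [blockDiag, hdiag]
  rw [hC, add_zero]
  refine Finset.sum_eq_zero fun y' _ => ?_
  by_cases hy : blk y' = blk y
  · rw [Finset.sum_eq_zero, zero_mul]
    intro x' _
    by_cases hx : blk x = blk x'
    · have : ¬ blk x' ≤ blk y' := by rw [← hx, hy]; exact hlt.not_ge
      simp [slidingMatrix, this]
    · simp [blockDiag, hx]
  · simp [blockDiag, hy]

theorem tailCard_filter {j a : ℕ} (p : BlockIdx j a → Prop) [DecidablePred p] (τ : Fin (j + 1)) :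
    tailCard (Finset.univ.filter p) τ =
      ∑ t ∈ Finset.Ici τ, (Finset.univ.filter fun i => p (toLex (t, i))).card := by
  simp only [tailCard, Finset.card_filter, Finset.filter_filter, sum_blockIdx]
  rw [← Finset.sum_subset (Finset.subset_univ (Finset.Ici τ))]
  · refine Finset.sum_congr rfl fun t ht => Finset.sum_congr rfl fun i _ => ?_
    have : τ ≤ blk (toLex (t, i) : BlockIdx j a) := Finset.mem_Ici.1 ht
    simp [this]
  · intro t _ ht
    refine Finset.sum_eq_zero fun i _ => ?_
    have : ¬ τ ≤ blk (toLex (t, i) : BlockIdx j a) := fun h => ht (Finset.mem_Ici.2 h)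
    simp [this]

theorem exists_tail_iff (j : ℕ) (f : ℕ → ℕ) :
    (∃ τ ≤ j, (j + 1 - τ) * r < ∑ t ∈ Finset.Ico τ (j + 1), f t) ↔
      ∃ τ : Fin (j + 1), ∑ _t ∈ Finset.Ici τ, r < ∑ t ∈ Finset.Ici τ, f t := by
  have hsum : ∀ τ : Fin (j + 1), ∑ t ∈ Finset.Ici τ, f t =
      ∑ t ∈ Finset.Ico (τ : ℕ) (j + 1), f t := fun τ => by
    rw [← Fin.map_valEmbedding_Ici, Finset.sum_map]
    rfl
  simp only [hsum, Finset.sum_const, Fin.card_Ici, smul_eq_mul]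
  exact ⟨fun ⟨τ, hτ, h⟩ => ⟨⟨τ, Nat.lt_succ_of_le hτ⟩, h⟩,
    fun ⟨τ, h⟩ => ⟨τ, Nat.lt_succ_iff.1 τ.2, h⟩⟩

/-! ### The equivalences -/

theorem columnDistance_eq_iff_diagSubmatricesNonsingular {M : ℕ} (b : Basis (Fin M) K F)
    (hk : 0 < k) (j : ℕ) :
    columnDistance b (convCode (systematicEncoder P)) j = (j + 1) * r + 1 ↔
      ∀ (A : Fin (j + 1) → Matrix (Fin r) (Fin r) K) (B : Fin (j + 1) → Matrix (Fin k) (Fin k) K)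
        (C : Fin (j + 1) → Matrix (Fin k) (Fin r) K),
        (∀ l, IsNonsingularUpper (A l)) → (∀ l, IsNonsingularUpper (B l)) →
          DiagSubmatricesNonsingular (matrixT P j A B C) := by
  classical
  have := b.finiteDimensional_of_finite
  rw [columnDistance_eq_iff P b hk, forall_lt_sum_blockWeight_iff]
  simp only [exists_tail_iff, diagSubmatricesNonsingular_iff, tailCard_filter]
  constructor
  · intro h A B C hA hB z hz
    let u : ℕ → Fin k → F := fun t => if ht : t < j + 1 then
      (fun i => z (toLex (⟨t, ht⟩, i))) ᵥ* (B ⟨t, ht⟩).map (algebraMap K F) else 0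
    have hu : ∀ t : Fin (j + 1),
        u t = (fun i => z (toLex (t, i))) ᵥ* (B t).map (algebraMap K F) := fun t => dif_pos t.2
    obtain ⟨τ, hτ⟩ := h u (by
      by_contra! h0
      refine hz (funext fun x => ?_)
      have hx := vecMul_map_inv_cancel (fun i => z (toLex (blk x, i))) (hB (blk x)).2
      rw [← hu, h0 _ (Nat.lt_succ_iff.1 (blk x).2), Matrix.zero_vecMul] at hx
      exact (congrFun hx (pos x)).symm)
    refine ⟨τ, ?_⟩
    have hsum := Finset.sum_le_sum fun t (_ : t ∈ Finset.Ici τ) =>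
      finrank_span_block_add_card_le (redundancy P u t) (hA t).2 (C t) (hu t).symm
    simp only [← vecMul_matrixT P A B C hu, Finset.sum_add_distrib] at hsum
    simp only [blockWeight] at hτ
    omega
  · intro h u hu0
    choose A B C z hA hB hzB hcard using fun t : Fin (j + 1) =>
      exists_reduced_block (K := K) (u t) (redundancy P u t)
    let z' : BlockIdx j k → F := fun x => z (blk x) (pos x)
    have hu : ∀ t : Fin (j + 1),
        u t = (fun i => z' (toLex (t, i))) ᵥ* (B t).map (algebraMap K F) :=
      fun t => (hzB t).symm
    obtain ⟨τ, hτ⟩ := h A B C hA hB z' (fun h0 => by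
      obtain ⟨t, ht, hut⟩ := hu0
      refine hut ((hu ⟨t, Nat.lt_succ_of_le ht⟩).trans ?_)
      rw [h0]
      exact Matrix.zero_vecMul _)
    refine ⟨τ, ?_⟩
    have hsum := Finset.sum_le_sum fun t (_ : t ∈ Finset.Ici τ) => hcard t
    simp only [Finset.sum_add_distrib] at hsum
    simp only [vecMul_matrixT P A B C hu] at hτ
    have hlt := (Nat.add_lt_add_right hτ _).trans_le hsum
    rw [add_comm] at hlt
    exact lt_of_add_lt_add_right hlt

end

theorem diagSubmatricesNonsingular_iff_shape {F : Type*} [Field F] {j a c : ℕ}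
    (T : Matrix (BlockIdx j a) (BlockIdx j c) F) :
    DiagSubmatricesNonsingular T ↔ IsSuperregularOfShape InBlocks T :=
  ⟨fun h ν x y ⟨σ, hσ⟩ => h ν x y (inBlocks_diag_of_perm x y σ hσ),
    fun h ν x y hxy => h ν x y ⟨1, hxy⟩⟩

theorem isSuperregularOfShape_iff {F α β : Type*} [Field F] [LinearOrder α] [LinearOrder β]
    {S : α → β → Prop} {T : Matrix α β F} (hT : ∀ x y, ¬ S x y → T x y = 0) :
    IsSuperregularOfShape S T ↔ (∀ x y, S x y → T x y ≠ 0) ∧ IsSuperregular T := by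
  constructor
  · refine fun h => ⟨fun x y hxy => ?_, fun ν x y ⟨σ, hσ⟩ => h ν x y ⟨σ, fun i => ?_⟩⟩
    · have := h 1 (OrderEmbedding.ofStrictMono (fun _ => x) (Subsingleton.strictMono _))
        (OrderEmbedding.ofStrictMono (fun _ => y) (Subsingleton.strictMono _)) ⟨1, fun _ => hxy⟩
      simpa using this
    · by_contra hS
      exact Finset.prod_ne_zero_iff.1 hσ i (Finset.mem_univ i) (hT _ _ hS)
  · rintro ⟨hne, h⟩ ν x y ⟨σ, hσ⟩
    exact h ν x y ⟨σ, Finset.prod_ne_zero_iff.2 fun i _ => hne _ _ (hσ i)⟩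

end MSR

theorem mainTheorem3 {K F : Type*} [Field K] [Finite K] [Field F] [Algebra K F]
    {M : ℕ} (b : Module.Basis (Fin M) K F) {n k m j : ℕ} (hk : 0 < k) (hkn : k ≤ n)
    (P : Matrix (Fin k) (Fin (n - k)) (Polynomial F))
    (hm : MSR.HasMemory (MSR.systematicEncoder P) m) (hj : j ≤ m) :
    List.TFAE [
      MSR.columnDistance b (MSR.convCode (MSR.systematicEncoder P)) j = (j + 1) * (n - k) + 1,
      ∀ (A : Fin (j + 1) → Matrix (Fin (n - k)) (Fin (n - k)) K)
        (B : Fin (j + 1) → Matrix (Fin k) (Fin k) K)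
        (C : Fin (j + 1) → Matrix (Fin k) (Fin (n - k)) K),
        (∀ l, MSR.IsNonsingularUpper (A l)) → (∀ l, MSR.IsNonsingularUpper (B l)) →
          MSR.DiagSubmatricesNonsingular (MSR.matrixT P j A B C),
      ∀ (A : Fin (j + 1) → Matrix (Fin (n - k)) (Fin (n - k)) K)
        (B : Fin (j + 1) → Matrix (Fin k) (Fin k) K)
        (C : Fin (j + 1) → Matrix (Fin k) (Fin (n - k)) K),
        (∀ l, MSR.IsNonsingularUpper (A l)) → (∀ l, MSR.IsNonsingularUpper (B l)) →
          MSR.IsSuperregularOfShape MSR.InBlocks (MSR.matrixT P j A B C),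
      ∀ (A : Fin (j + 1) → Matrix (Fin (n - k)) (Fin (n - k)) K)
        (B : Fin (j + 1) → Matrix (Fin k) (Fin k) K)
        (C : Fin (j + 1) → Matrix (Fin k) (Fin (n - k)) K),
        (∀ l, MSR.IsNonsingularUpper (A l)) → (∀ l, MSR.IsNonsingularUpper (B l)) →
          (∀ x y, MSR.InBlocks x y → MSR.matrixT P j A B C x y ≠ 0) ∧
            MSR.IsSuperregular (MSR.matrixT P j A B C)] := by
  tfae_have 1 ↔ 2 := MSR.columnDistance_eq_iff_diagSubmatricesNonsingular P b hk j
  tfae_have 2 ↔ 3 := by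
    simp only [MSR.diagSubmatricesNonsingular_iff_shape]
  tfae_have 3 ↔ 4 := by
    simp only [← MSR.isSuperregularOfShape_iff fun _ _ => MSR.matrixT_eq_zero P _ _ _]
  tfae_finish
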